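/- Let $M\ge 0$, $N\ge 1$, let $H\in\mathbb{R}^{M\times N}$ have strictly positive entries and let $x_0\in\mathbb{R}^N$ have strictly positive entries (the usual choice is $x_0=(1,\dots,1)$). For $y\in\mathbb{R}^M_+$ (vectors with nonnegative entries) let $R_k(y)$ be the $k$-th iterate of the EM algorithm with background $b=0$, that is $R_0(y)=x_0$ and $R_{k+1}(y)=\psi_y(R_k(y))$, where $$\psi_y(x)=\frac{x}{H^T 1}\,H^T\Big(\frac{y}{Hx}\Big)$$ with products and quotients of vectors taken componentwise and $1=(1,\dots,1)$. For $u\in\mathbb{R}^M_+$ and $v$ with positive entries put $$D_{\mathrm{KL}}(u,v)=\sum_{i=1}^M\Big(u_i\log\frac{u_i}{v_i}+v_i-u_i\Big)\qquad(0\log 0=0),$$ and let $\mathcal{R}_+(H)=\{Hx : x\in\mathbb{R}^N_+\}$. Let $\|\cdot\|$ be the Euclidean norm. For every direction $u\in\mathbb{R}^M$ there is a threshold $T\in\mathbb{R}$ (depending only on $H$, $x_0$ and $u$) with the following property. Let $\hat H\in\mathbb{R}^{M\times N}$ have nonnegative entries, let $x\in\mathbb{R}^N_+$, and let $y$ be a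 realization of a random vector $Y\sim\mathcal{P}(\hat H x)$, that is, the components of $Y$ are independent Poisson variables with mean values $(\hat Hx)_i$. If $y\notin\mathcal{R}_+(H)$, $y/\|y\|=u$ and $\|y\|\ge T$, then for every $k\in\mathbb{N}$ all components of $HR_k(y)$ are positive and $$D_{\mathrm{KL}}(y,HR_k(y))>\frac{M}{2}.$$ In particular the Poisson discrepancy principle, which stops the EM iteration at $k$ once $D_{\mathrm{KL}}(y,HR_k(y))<M/2$, never stops it. -/

import Mathlib

open MeasureTheory ProbabilityTheory
open scoped Matrix

/-- The Kullback-Leibler divergence `∑ i, (u i * log (u i / v i) + v i - u i)` of a vector `u` with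
nonnegative entries from a vector `v` with positive entries (with `0 * log 0 = 0`). -/
noncomputable def vecKL {M : ℕ} (u v : Fin M → ℝ) : ℝ :=
  ∑ i, (u i * Real.log (u i / v i) + v i - u i)

/-- The EM map `ψ_y(x) = x / (Hᵀ 1) * Hᵀ (y / (H x + b))`, all products and quotients of vectors
being taken componentwise. -/
noncomputable def emMap {M N : ℕ} (H : Matrix (Fin M) (Fin N) ℝ) (b y : Fin M → ℝ)
    (x : Fin N → ℝ) : Fin N → ℝ :=
  fun j => x j / (Hᵀ *ᵥ (fun _ => (1 : ℝ))) j * (Hᵀ *ᵥ (fun i => y i / ((H *ᵥ x) i + b i))) j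

/-- The `k`-th EM iterate `R_k(y)`, starting from `R_0(y) = x₀`. -/
noncomputable def emIterate {M N : ℕ} (H : Matrix (Fin M) (Fin N) ℝ) (b : Fin M → ℝ)
    (x₀ : Fin N → ℝ) (k : ℕ) (y : Fin M → ℝ) : Fin N → ℝ :=
  (emMap H b y)^[k] x₀

/-- The Poisson discrepancy principle is satisfied at iteration `k`, i.e. it stops the EM algorithm:
`D_KL(y, H R_k(y) + b) < M / 2`. -/
def DiscrepancyPrincipleAt {M N : ℕ} (H : Matrix (Fin M) (Fin N) ℝ) (b : Fin M → ℝ)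
    (x₀ : Fin N → ℝ) (y : Fin M → ℝ) (k : ℕ) : Prop :=
  vecKL y (H *ᵥ emIterate H b x₀ k y + b) < (M : ℝ) / 2

/-- The cone `{C x : x ≥ 0}`, the image of the nonnegative orthant under the matrix `C`. -/
def imageCone {M N : ℕ} (C : Matrix (Fin M) (Fin N) ℝ) : Set (Fin M → ℝ) :=
  {v | ∃ x : Fin N → ℝ, (∀ j, 0 ≤ x j) ∧ C *ᵥ x = v}

/-- The Euclidean norm of a vector. -/
noncomputable def euclNorm {M : ℕ} (y : Fin M → ℝ) : ℝ :=
  ‖(WithLp.toLp 2 y : EuclideanSpace ℝ (Fin M))‖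

/-- The law of a random vector with independent Poisson components of mean values `lam i ≥ 0`. -/
noncomputable def poissonVecLaw {M : ℕ} (lam : Fin M → ℝ) : Measure (Fin M → ℕ) :=
  Measure.pi fun i => poissonMeasure (lam i).toNNReal

/-! The divergence dominates the squared Hellinger distance `∑ (√u - √v)²`, which is homogeneous of
degree one, and the cone of `H` is invariant under scaling. So if `u` has squared Hellinger distance
at least `c > 0` from the cone (`exists_pos_le_sum_sq_sqrt_sub_sqrt`), then `y = t • u` has
divergence at least `t * c` from every positive point of it, which exceeds `M / 2` for large `t`. Of
the EM iteration only the positivity of its iterates matters; of the Poisson law, only `y ≥ 0`. -/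

/-- One summand of the Kullback-Leibler divergence dominates the squared Hellinger distance. -/
lemma sq_sqrt_sub_sqrt_le_klTerm {a b : ℝ} (ha : 0 ≤ a) (hb : 0 < b) :
    (√a - √b) ^ 2 ≤ a * Real.log (a / b) + b - a := by
  rcases ha.eq_or_lt with rfl | ha
  · simp [Real.sq_sqrt hb.le]
  have hsa := Real.sqrt_pos.2 ha
  have hsb := Real.sqrt_pos.2 hb
  have h1 := Real.sq_sqrt ha.le
  have h2 := Real.sq_sqrt hb.le
  -- Passing to square roots before using `log s ≤ s - 1` produces the cross term `√a * √b`; with `s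
  -- = b / a` the bound would only be `0`.
  have hlog : Real.log (a / b) = -(2 * Real.log (√b / √a)) := by
    rw [Real.log_div ha.ne' hb.ne', Real.log_div hsb.ne' hsa.ne', Real.log_sqrt ha.le,
      Real.log_sqrt hb.le]
    ring
  have hle := Real.log_le_sub_one_of_pos (div_pos hsb hsa)
  have hmul : a * Real.log (√b / √a) ≤ √a * √b - a := by
    calc a * Real.log (√b / √a) ≤ a * (√b / √a - 1) := mul_le_mul_of_nonneg_left hle ha.le
      _ = √a ^ 2 * (√b / √a - 1) := by rw [h1]
      _ = √a * √b - √a ^ 2 := by field_simp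
      _ = √a * √b - a := by rw [h1]
  rw [hlog]
  nlinarith

lemma sum_sq_sqrt_sub_sqrt_le_vecKL {M : ℕ} {u v : Fin M → ℝ} (hu : ∀ i, 0 ≤ u i)
    (hv : ∀ i, 0 < v i) : ∑ i, (√(u i) - √(v i)) ^ 2 ≤ vecKL u v :=
  Finset.sum_le_sum fun i _ => sq_sqrt_sub_sqrt_le_klTerm (hu i) (hv i)

lemma mulVec_pos_of_pos {M N : ℕ} (hN : 0 < N) {H : Matrix (Fin M) (Fin N) ℝ}
    (hH : ∀ i j, 0 < H i j) {x : Fin N → ℝ} (hx : ∀ j, 0 < x j) (i : Fin M) :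
    0 < (H *ᵥ x) i :=
  Finset.sum_pos (fun j _ => mul_pos (hH i j) (hx j)) ⟨⟨0, hN⟩, Finset.mem_univ _⟩

lemma emMap_pos {M N : ℕ} (hN : 0 < N) {H : Matrix (Fin M) (Fin N) ℝ} (hH : ∀ i j, 0 < H i j)
    {y : Fin M → ℝ} (hy : ∀ i, 0 ≤ y i) (hy0 : ∃ i, 0 < y i) {x : Fin N → ℝ}
    (hx : ∀ j, 0 < x j) (j : Fin N) : 0 < emMap H 0 y x j := by
  obtain ⟨i₀, hi₀⟩ := hy0
  have hHx : ∀ i, 0 < (H *ᵥ x) i := mulVec_pos_of_pos hN hH hx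
  refine mul_pos (div_pos (hx j) ?_) ?_
  · exact Finset.sum_pos (fun i _ => mul_pos (hH i j) one_pos) ⟨i₀, Finset.mem_univ _⟩
  · refine Finset.sum_pos' (fun i _ => mul_nonneg (hH i j).le ?_) ⟨i₀, Finset.mem_univ _, ?_⟩
    · simpa using div_nonneg (hy i) (hHx i).le
    · exact mul_pos (hH i₀ j) (by simpa using div_pos hi₀ (hHx i₀))

lemma emIterate_pos {M N : ℕ} (hN : 0 < N) {H : Matrix (Fin M) (Fin N) ℝ}
    (hH : ∀ i j, 0 < H i j) {y : Fin M → ℝ} (hy : ∀ i, 0 ≤ y i) (hy0 : ∃ i, 0 < y i)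
    {x₀ : Fin N → ℝ} (hx₀ : ∀ j, 0 < x₀ j) (k : ℕ) : ∀ j, 0 < emIterate H 0 x₀ k y j := by
  induction k with
  | zero => exact hx₀
  | succ k ih =>
    rw [emIterate, Function.iterate_succ_apply']
    exact emMap_pos hN hH hy hy0 ih

/-- A nonnegative vector outside the cone of a positive matrix has positive Hellinger distance
from that cone. -/
lemma exists_pos_le_sum_sq_sqrt_sub_sqrt {M N : ℕ} {H : Matrix (Fin M) (Fin N) ℝ}
    (hH : ∀ i j, 0 < H i j) {u : Fin M → ℝ} (hu : ∀ i, 0 ≤ u i) (hmem : u ∉ imageCone H) :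
    ∃ c > 0, ∀ x : Fin N → ℝ, (∀ j, 0 ≤ x j) → c ≤ ∑ i, (√(u i) - √((H *ᵥ x) i)) ^ 2 := by
  have hM : Nonempty (Fin M) := by
    by_contra hM
    rw [not_nonempty_iff] at hM
    exact hmem ⟨0, fun _ => le_rfl, Subsingleton.elim _ _⟩
  obtain ⟨i₀⟩ := hM
  set f : (Fin N → ℝ) → ℝ := fun x => ∑ i, (√(u i) - √((H *ᵥ x) i)) ^ 2
  have hcont : Continuous f := by
    have hlin : ∀ i, Continuous fun x : Fin N → ℝ => (H *ᵥ x) i := fun i =>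
      (continuous_apply i).comp (continuous_const.matrix_mulVec continuous_id)
    exact continuous_finsetSum _ fun i _ => (continuous_const.sub (hlin i).sqrt).pow 2
  -- Compactness on the box `[0, B]^N` gives a minimum. Outside it, one large coordinate already
  -- makes summand `i₀` at least `1`; the sum over `j` stands in for a maximum.
  set B : ℝ := ∑ j, (√(u i₀) + 1) ^ 2 / H i₀ j
  have hterm : ∀ j, 0 ≤ (√(u i₀) + 1) ^ 2 / H i₀ j := fun j => div_nonneg (sq_nonneg _) (hH i₀ j).le
  have hB0 : 0 ≤ B := Finset.sum_nonneg fun j _ => hterm j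
  obtain ⟨z, hz, hmin⟩ := (isCompact_Icc (a := (0 : Fin N → ℝ)) (b := fun _ => B)).exists_isMinOn
    ⟨0, le_rfl, fun _ => hB0⟩ hcont.continuousOn
  have hzpos : 0 < f z := by
    refine (Finset.sum_nonneg fun i _ => sq_nonneg _).lt_of_ne' fun h0 => hmem ⟨z, hz.1, ?_⟩
    have h := (Finset.sum_eq_zero_iff_of_nonneg fun i _ => sq_nonneg _).1 h0
    ext i
    have hi := sub_eq_zero.1 (pow_eq_zero_iff two_ne_zero |>.1 (h i (Finset.mem_univ i)))
    have hHz : 0 ≤ (H *ᵥ z) i := by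
      rw [Matrix.mulVec, dotProduct]
      exact Finset.sum_nonneg fun j _ => mul_nonneg (hH i j).le (hz.1 j)
    exact ((Real.sqrt_inj (hu i) hHz).1 hi).symm
  refine ⟨min (f z) 1, lt_min hzpos one_pos, fun x hx => ?_⟩
  by_cases hxB : ∀ j, x j ≤ B
  · exact (min_le_left _ _).trans (hmin ⟨hx, hxB⟩)
  push Not at hxB
  obtain ⟨j, hj⟩ := hxB
  refine (min_le_right _ _).trans ?_
  have hbig : (√(u i₀) + 1) ^ 2 ≤ (H *ᵥ x) i₀ :=
    calc (√(u i₀) + 1) ^ 2 = H i₀ j * ((√(u i₀) + 1) ^ 2 / H i₀ j) :=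
          (mul_div_cancel₀ _ (hH i₀ j).ne').symm
      _ ≤ H i₀ j * x j := by
          refine mul_le_mul_of_nonneg_left (le_trans ?_ hj.le) (hH i₀ j).le
          exact Finset.single_le_sum (fun j _ => hterm j) (Finset.mem_univ j)
      _ ≤ (H *ᵥ x) i₀ :=
          Finset.single_le_sum (f := fun j => H i₀ j * x j)
            (fun j _ => mul_nonneg (hH i₀ j).le (hx j)) (Finset.mem_univ j)
  have hsqrt : √(u i₀) + 1 ≤ √((H *ᵥ x) i₀) := Real.le_sqrt_of_sq_le hbig
  calc (1 : ℝ) ≤ (√(u i₀) - √((H *ᵥ x) i₀)) ^ 2 := by nlinarith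
    _ ≤ f x := Finset.single_le_sum (f := fun i => (√(u i) - √((H *ᵥ x) i)) ^ 2)
        (fun i _ => sq_nonneg _) (Finset.mem_univ i₀)

lemma smul_mem_imageCone {M N : ℕ} {H : Matrix (Fin M) (Fin N) ℝ} {v : Fin M → ℝ}
    (hv : v ∈ imageCone H) {t : ℝ} (ht : 0 ≤ t) : t • v ∈ imageCone H := by
  obtain ⟨x, hx, rfl⟩ := hv
  exact ⟨t • x, fun j => mul_nonneg ht (hx j), Matrix.mulVec_smul H t x⟩

lemma sum_sq_sqrt_sub_sqrt_smul {M : ℕ} {t : ℝ} (ht : 0 ≤ t) (u v : Fin M → ℝ) :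
    ∑ i, (√((t • u) i) - √((t • v) i)) ^ 2 = t * ∑ i, (√(u i) - √(v i)) ^ 2 := by
  rw [Finset.mul_sum]
  refine Finset.sum_congr rfl fun i _ => ?_
  rw [Pi.smul_apply, Pi.smul_apply, smul_eq_mul, smul_eq_mul, Real.sqrt_mul ht, Real.sqrt_mul ht,
    ← mul_sub, mul_pow, Real.sq_sqrt ht]

theorem mainTheorem5 {M N : ℕ} (hN : 0 < N)
    (H : Matrix (Fin M) (Fin N) ℝ) (hH : ∀ i j, 0 < H i j)
    (x₀ : Fin N → ℝ) (hx₀ : ∀ j, 0 < x₀ j) (u : Fin M → ℝ) :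
    ∃ T : ℝ, ∀ (Hhat : Matrix (Fin M) (Fin N) ℝ) (x : Fin N → ℝ),
      (∀ i j, 0 ≤ Hhat i j) → (∀ j, 0 ≤ x j) →
      ∀ (Ω : Type*) [MeasurableSpace Ω] (P : Measure Ω) [IsProbabilityMeasure P]
        (Y : Ω → Fin M → ℕ), HasLaw Y (poissonVecLaw (Hhat *ᵥ x)) P →
      ∀ (ω : Ω) (y : Fin M → ℝ), (∀ i, y i = (Y ω i : ℝ)) →
        y ∉ imageCone H → (euclNorm y)⁻¹ • y = u → T ≤ euclNorm y →
        (∀ k : ℕ, (∀ i, 0 < (H *ᵥ emIterate H 0 x₀ k y) i) ∧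
          (M : ℝ) / 2 < vecKL y (H *ᵥ emIterate H 0 x₀ k y)) ∧
        ∀ k : ℕ, ¬ DiscrepancyPrincipleAt H 0 x₀ y k := by
  by_cases hdir : (∀ i, 0 ≤ u i) ∧ u ∉ imageCone H
  · obtain ⟨c, hc, hcu⟩ := exists_pos_le_sum_sq_sqrt_sub_sqrt hH hdir.1 hdir.2
    -- The `+ 1` makes `M / 2 < t * c` strict and `t` positive.
    refine ⟨M / 2 / c + 1, ?_⟩
    intro Hhat x _ _ Ω _ P _ Y _ ω y hy hmem hyu hT
    have hy0 : ∀ i, 0 ≤ y i := fun i => hy i ▸ Nat.cast_nonneg _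
    have ht : 0 < euclNorm y := lt_of_lt_of_le (by positivity) hT
    set t := euclNorm y
    have hyt : y = t • u := by rw [← hyu, smul_inv_smul₀ ht.ne']
    have hypos : ∃ i, 0 < y i := by
      by_contra! h
      refine hmem ⟨0, fun _ => le_rfl, ?_⟩
      rw [Matrix.mulVec_zero]
      exact funext fun i => le_antisymm (hy0 i) (h i)
    have main : ∀ k : ℕ, (∀ i, 0 < (H *ᵥ emIterate H 0 x₀ k y) i) ∧
        (M : ℝ) / 2 < vecKL y (H *ᵥ emIterate H 0 x₀ k y) := by
      intro k
      have hR := emIterate_pos hN hH hy0 hypos hx₀ k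
      set r := emIterate H 0 x₀ k y
      have hpos := mulVec_pos_of_pos hN hH hR
      refine ⟨hpos, ?_⟩
      -- The rescaled iterate `t⁻¹ • r` is the point of the orthant to compare with `u`.
      have hr : H *ᵥ r = t • (H *ᵥ (t⁻¹ • r)) := by
        rw [← Matrix.mulVec_smul, smul_inv_smul₀ ht.ne']
      calc (M : ℝ) / 2 < t * c := by rw [← div_lt_iff₀ hc]; linarith
        _ ≤ t * ∑ i, (√(u i) - √((H *ᵥ (t⁻¹ • r)) i)) ^ 2 :=
          mul_le_mul_of_nonneg_left
            (hcu _ fun j => mul_nonneg (inv_nonneg.2 ht.le) (hR j).le) ht.le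
        _ = ∑ i, (√(y i) - √((H *ᵥ r) i)) ^ 2 := by
          rw [← sum_sq_sqrt_sub_sqrt_smul ht.le, ← hr, ← hyt]
        _ ≤ vecKL y (H *ᵥ r) := sum_sq_sqrt_sub_sqrt_le_vecKL hy0 hpos
    refine ⟨main, fun k hk => ?_⟩
    rw [DiscrepancyPrincipleAt, add_zero] at hk
    exact lt_asymm hk (main k).2
  -- No admissible `y` has such a direction; `1` only ensures `y ≠ 0`.
  · refine ⟨1, ?_⟩
    intro Hhat x _ _ Ω _ P _ Y _ ω y hy hmem hyu hT
    have ht : 0 < euclNorm y := one_pos.trans_le hT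
    refine absurd ⟨fun i => ?_, fun h => hmem ?_⟩ hdir
    · rw [← hyu]
      exact mul_nonneg (inv_nonneg.2 ht.le) (hy i ▸ Nat.cast_nonneg _)
    · have hyt : y = euclNorm y • u := by rw [← hyu, smul_inv_smul₀ ht.ne']
      rw [hyt]
      exact smul_mem_imageCone h ht.le
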